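/- For graphs $H$ and $G$ let $\mathcal N(H,G)$ denote the number of (not necessarily induced) subgraphs of $G$ isomorphic to $H$. A graph is $F$-free if it has no subgraph isomorphic to $F$, and $\mathrm{ex}(n,H,F)$ is the maximum of $\mathcal N(H,G)$ over all $n$-vertex $F$-free graphs $G$. Let $T_r(n)$ be the Turán graph, i.e. the complete $r$-partite graph on $n$ vertices whose class sizes differ by at most one. If $F$ has chromatic number $k\ge 2$ and $H$ does not contain $F$ as a subgraph, then $H$ is called $F$-Turán-good if $\mathrm{ex}(n,H,F)=\mathcal N(H,T_{k-1}(n))$ for every sufficiently large $n$. An edge $e$ of $F$ is color-critical if deleting $e$ from $F$ gives a graph of smaller chromatic number. Let $F_2$ be the graph consisting of two triangles that share exactly one vertex. Then the cycle $C_4$ is $F_2$-Turán-good, and $F_2$ has no color-critical edge. -/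

import Mathlib

namespace GenTuran

open scoped Classical in
/-- `ex(n, H, F)`: the maximum number of (not necessarily induced, unlabelled) copies of `H` in an
`F`-free graph on `n` vertices.  Here `G.copyCount H` is the number of subgraphs of `G` isomorphic
to `H`, and `F.Free G` says that no subgraph of `G` is isomorphic to `F`. -/
noncomputable def ex {V W : Type*} (n : ℕ) (H : SimpleGraph V) (F : SimpleGraph W) : ℕ :=
  (Finset.univ.filter (fun G : SimpleGraph (Fin n) => F.Free G)).sup (fun G => G.copyCount H)

/-- `H` is `F`-Turán-good: `F` has chromatic number `k`, `H` does not contain `F`, and for every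
large enough `n` the Turán graph `T_{k-1}(n)` attains `ex(n, H, F)`.
(For `k < 2` there is no Turán graph `T_{k-1}(n)`.) -/
def IsTuranGood {V W : Type*} (H : SimpleGraph V) (F : SimpleGraph W) : Prop :=
  ∃ k : ℕ, 2 ≤ k ∧ F.chromaticNumber = (k : ℕ∞) ∧ F.Free H ∧
    ∃ n₀ : ℕ, ∀ n : ℕ, n₀ ≤ n →
      ex n H F = (SimpleGraph.turanGraph n (k - 1)).copyCount H

/-- `e` is a color-critical edge of `F`: deleting it lowers the chromatic number. -/
def IsColorCritical {W : Type*} (F : SimpleGraph W) (e : Sym2 W) : Prop :=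
  e ∈ F.edgeSet ∧ (F.deleteEdges {e}).chromaticNumber < F.chromaticNumber

/-- `F_2`: the two triangles `0 1 2` and `0 3 4`, sharing exactly the vertex `0`. -/
def fanTwo : SimpleGraph (Fin 5) :=
  SimpleGraph.fromEdgeSet {s(0, 1), s(0, 2), s(1, 2), s(0, 3), s(0, 4), s(3, 4)}

end GenTuran

namespace GenTuran

/-! Labelled four-cycles are counted edge by edge: their number is the sum, over ordered adjacent
pairs `(u, v)`, of the number of squares `u a b v`. Write `M = (⌈n/2⌉ - 1)(⌊n/2⌋ - 1)`. In a
bowtie-free graph every edge lies in at most `M` squares (`card_squarePairs_le`), and in the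
balanced complete bipartite graph every edge attains `M`. So a graph with at most `n²/4` edges
satisfies the bound at once.

A bowtie-free graph may have slightly more edges. A `K₄` prevents this, by
`BowtieFree.two_mul_card_adjPairs_le_of_four_clique`. Without `K₄`, a set `R` of at most `n/3`
edges, from disjoint triangles, meets all triangles (`BowtieFree.exists_transversal`), and Mantel
bounds `G' = G - R`. If no square uses an edge of `R`, nothing is lost. If a square `u a b v` has
`uv ∈ R`, then `ab ∈ R`, since otherwise `G'` has a five-cycle and `G` too few edges. Now `ua` and
`vb` form an induced matching of `G'`, which puts `G'` at least two edges below the Mantel bound.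
The `4M` ordered squares so gained exceed the at most `(2|R|)²` ordered squares on edges of `R`. -/

open Finset

/-! ### Labelled copies, and four-cycles counted by edges -/

/-- The labelled copies of `H` in `G` are counted by the unlabelled ones times the number of
automorphisms of `H`. -/
theorem labelledCopyCount_eq_copyCount_mul {V W : Type*} [Fintype V] [Fintype W]
    (G : SimpleGraph V) (H : SimpleGraph W) :
    G.labelledCopyCount H = G.copyCount H * Nat.card (H ≃g H) := by
  classical
  have hfin : Finite (H ≃g H) :=
    Finite.of_injective (fun e : H ≃g H => (e : W → W)) DFunLike.coe_injective
  have := Fintype.ofFinite (H ≃g H)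
  rw [SimpleGraph.labelledCopyCount, SimpleGraph.copyCount_eq_card_image_copyToSubgraph,
    ← Finset.card_univ]
  rw [Finset.card_eq_sum_card_image SimpleGraph.Copy.toSubgraph]
  refine Finset.sum_const_nat ?_
  intro G' hG'
  obtain ⟨f₀, -, rfl⟩ := Finset.mem_image.1 hG'
  rw [Nat.card_eq_fintype_card, ← Finset.card_univ, eq_comm]
  -- Automorphisms act simply transitively, by precomposition, on the copies with a given image.
  refine Finset.card_bij (fun σ _ => f₀.comp σ.toCopy) ?_ ?_ ?_
  · intro σ _
    simp only [Finset.mem_filter, Finset.mem_univ, true_and]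
    ext x y
    · simp only [SimpleGraph.Subgraph.map_verts, SimpleGraph.Subgraph.verts_top, Set.image_univ,
        Set.mem_range]
      exact ⟨fun ⟨w, hw⟩ => ⟨σ w, hw⟩, fun ⟨w, hw⟩ => ⟨σ.symm w, by
        simpa [SimpleGraph.Copy.comp_apply] using hw⟩⟩
    · simp only [SimpleGraph.Subgraph.map_adj, Relation.Map, SimpleGraph.Subgraph.top_adj]
      exact ⟨fun ⟨a, b, h, ha, hb⟩ => ⟨σ a, σ b, σ.map_adj_iff.2 h, ha, hb⟩,
        fun ⟨a, b, h, ha, hb⟩ => ⟨σ.symm a, σ.symm b, σ.symm.map_adj_iff.2 h, by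
          simpa [SimpleGraph.Copy.comp_apply] using ha, by
          simpa [SimpleGraph.Copy.comp_apply] using hb⟩⟩
  · intro σ _ τ _ h
    ext w
    exact f₀.injective (DFunLike.congr_fun h w)
  · intro f hf
    have hf : f.toSubgraph = f₀.toSubgraph := by simpa using hf
    have hv : ∀ w, ∃ w', f₀ w' = f w := by
      intro w
      have : f w ∈ f₀.toSubgraph.verts := by rw [← hf]; simp
      simpa using this
    have hv' : ∀ w, ∃ w', f w' = f₀ w := by
      intro w
      have : f₀ w ∈ f.toSubgraph.verts := by rw [hf]; simp
      simpa using this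
    choose s hs using hv
    choose t ht using hv'
    have hst : ∀ w, s (t w) = w := fun w => f₀.injective ((hs _).trans (ht _))
    have hts : ∀ w, t (s w) = w := fun w => f.injective ((ht _).trans (hs _))
    have hadj : ∀ a b, H.Adj (s a) (s b) ↔ H.Adj a b := by
      intro a b
      have key : ∀ (g : SimpleGraph.Copy H G) (x y : W),
          g.toSubgraph.Adj (g x) (g y) ↔ H.Adj x y := by
        intro g x y
        simp only [SimpleGraph.Subgraph.map_adj, Relation.Map, SimpleGraph.Subgraph.top_adj]
        refine ⟨?_, fun h => ⟨x, y, h, rfl, rfl⟩⟩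
        rintro ⟨x', y', h, hx, hy⟩
        rwa [g.injective hx, g.injective hy] at h
      rw [← key f₀, hs, hs, ← hf, key f]
    exact ⟨⟨⟨s, t, hts, hst⟩, hadj _ _⟩, Finset.mem_univ _, SimpleGraph.Copy.ext hs⟩

theorem cycleGraph_four_adj_iff {i j : Fin 4} :
    (SimpleGraph.cycleGraph 4).Adj i j ↔ j = i + 1 ∨ i = j + 1 := by
  revert i j
  decide

theorem exists_copy_cycleGraph_four {V : Type*} {G : SimpleGraph V} {u v a b : V}
    (huv : G.Adj u v) (hua : G.Adj u a) (hab : G.Adj a b) (hbv : G.Adj b v) (hav : a ≠ v)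
    (hbu : b ≠ u) :
    ∃ f : SimpleGraph.Copy (SimpleGraph.cycleGraph 4) G, f 0 = u ∧ f 1 = a ∧ f 2 = b ∧ f 3 = v := by
  have hstep : ∀ i : Fin 4, G.Adj (![u, a, b, v] i) (![u, a, b, v] (i + 1)) := by
    intro i
    fin_cases i
    exacts [hua, hab, hbv, huv.symm]
  have hinj : Function.Injective ![u, a, b, v] := by
    have h1 := huv.ne
    have h2 := hua.ne
    have h3 := hab.ne
    have h4 := hbv.ne
    intro i j hij
    fin_cases i <;> fin_cases j <;> simp_all [eq_comm]
  refine ⟨⟨⟨![u, a, b, v], ?_⟩, hinj⟩, rfl, rfl, rfl, rfl⟩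
  intro i j hij
  rcases cycleGraph_four_adj_iff.1 hij with rfl | rfl
  · exact hstep i
  · exact (hstep j).symm

open scoped Classical in
/-- The ordered pairs of adjacent vertices. -/
noncomputable def adjPairs {V : Type*} [Fintype V] (G : SimpleGraph V) : Finset (V × V) :=
  univ.filter fun p => G.Adj p.1 p.2

open scoped Classical in
/-- The pairs `(a, b)` completing `u` and `v` to a four-cycle `u a b v`. -/
noncomputable def squarePairs {V : Type*} [Fintype V] (G : SimpleGraph V) (u v : V) :
    Finset (V × V) :=
  univ.filter fun q => G.Adj u q.1 ∧ G.Adj q.1 q.2 ∧ G.Adj q.2 v ∧ q.1 ≠ v ∧ q.2 ≠ u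

section
variable {V : Type*} [Fintype V] {G : SimpleGraph V}

@[simp] theorem mem_adjPairs {p : V × V} : p ∈ adjPairs G ↔ G.Adj p.1 p.2 := by
  simp [adjPairs]

@[simp] theorem mem_squarePairs {u v : V} {q : V × V} : q ∈ squarePairs G u v ↔
    G.Adj u q.1 ∧ G.Adj q.1 q.2 ∧ G.Adj q.2 v ∧ q.1 ≠ v ∧ q.2 ≠ u := by
  simp [squarePairs]

theorem labelledCopyCount_eq_natCard {W : Type*} [Fintype W] (H : SimpleGraph W) :
    G.labelledCopyCount H = Nat.card (SimpleGraph.Copy H G) := by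
  classical
  rw [SimpleGraph.labelledCopyCount, Nat.card_eq_fintype_card]

theorem labelledCopyCount_cycleGraph_four :
    G.labelledCopyCount (SimpleGraph.cycleGraph 4) =
      ∑ p ∈ adjPairs G, #(squarePairs G p.1 p.2) := by
  rw [labelledCopyCount_eq_natCard,
    ← Finset.card_sigma (adjPairs G) fun p => squarePairs G p.1 p.2, ← Nat.card_eq_finsetCard]
  refine Nat.card_eq_of_bijective (fun f => ⟨⟨(f 0, f 3), (f 1, f 2)⟩, ?_⟩) ⟨?_, ?_⟩
  · have h : ∀ i j : Fin 4, j = i + 1 → G.Adj (f i) (f j) :=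
      fun i j hij => f.toHom.map_adj (cycleGraph_four_adj_iff.2 (Or.inl hij))
    have inj : ∀ i j : Fin 4, i ≠ j → f i ≠ f j := fun i j hij h => hij (f.injective h)
    simp only [Finset.mem_sigma, mem_adjPairs, mem_squarePairs]
    exact ⟨(h 3 0 (by decide)).symm, h 0 1 (by decide), h 1 2 (by decide), h 2 3 (by decide),
      inj 1 3 (by decide), inj 2 0 (by decide)⟩
  · intro f g hfg
    simp only [Subtype.mk.injEq, Sigma.mk.injEq, Prod.mk.injEq, heq_eq_eq] at hfg
    refine SimpleGraph.Copy.ext (Fin.forall_fin_succ.2 ⟨hfg.1.1, Fin.forall_fin_succ.2 ⟨hfg.2.1,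
      Fin.forall_fin_succ.2 ⟨hfg.2.2, Fin.forall_fin_succ.2 ⟨hfg.1.2, fun i => i.elim0⟩⟩⟩⟩)
  · rintro ⟨⟨⟨u, v⟩, a, b⟩, h⟩
    simp only [Finset.mem_sigma, mem_adjPairs, mem_squarePairs] at h
    obtain ⟨huv, hua, hab, hbv, hav, hbu⟩ := h
    obtain ⟨f, h0, h1, h2, h3⟩ := exists_copy_cycleGraph_four huv hua hab hbv hav hbu
    exact ⟨f, by simp only [h0, h1, h2, h3]⟩

end

/-! ### The bowtie and its chromatic number -/

/-- No two triangles of `G` share exactly one vertex. -/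
def BowtieFree {V : Type*} (G : SimpleGraph V) : Prop :=
  ∀ ⦃x a b c d : V⦄, G.Adj x a → G.Adj x b → G.Adj x c → G.Adj x d → G.Adj a b → G.Adj c d →
    a ≠ c → a ≠ d → b ≠ c → b ≠ d → False

theorem fanTwo_adj_iff (i j : Fin 5) : fanTwo.Adj i j ↔
    i ≠ j ∧ (i = 0 ∨ j = 0 ∨ (i = 1 ∧ j = 2) ∨ (i = 2 ∧ j = 1) ∨ (i = 3 ∧ j = 4) ∨
      (i = 4 ∧ j = 3)) := by
  simp only [fanTwo, SimpleGraph.fromEdgeSet_adj, Set.mem_insert_iff, Set.mem_singleton_iff]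
  revert i j
  decide

theorem bowtieFree_of_free {V : Type*} {G : SimpleGraph V} (h : fanTwo.Free G) :
    BowtieFree G := by
  intro x a b c d hxa hxb hxc hxd hab hcd hac had hbc hbd
  refine h ⟨⟨⟨![x, a, b, c, d], ?_⟩, ?_⟩⟩
  · intro i j hij
    obtain ⟨hne, hij⟩ := (fanTwo_adj_iff i j).1 hij
    have h0 : ∀ k : Fin 5, k ≠ 0 → G.Adj x (![x, a, b, c, d] k) := by
      intro k hk
      fin_cases k
      exacts [absurd rfl hk, hxa, hxb, hxc, hxd]
    rcases hij with rfl | rfl | ⟨rfl, rfl⟩ | ⟨rfl, rfl⟩ | ⟨rfl, rfl⟩ | ⟨rfl, rfl⟩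
    exacts [h0 j hne.symm, (h0 i hne).symm, hab, hab.symm, hcd, hcd.symm]
  · have h1 := hxa.ne
    have h2 := hxb.ne
    have h3 := hxc.ne
    have h4 := hxd.ne
    have h5 := hab.ne
    have h6 := hcd.ne
    intro i j hij
    fin_cases i <;> fin_cases j <;> simp_all [eq_comm]

theorem not_colorable_two_of_triangle {V : Type*} {G : SimpleGraph V} {x y z : V}
    (hxy : G.Adj x y) (hxz : G.Adj x z) (hyz : G.Adj y z) : ¬ G.Colorable 2 := by
  rintro ⟨c⟩
  have h1 := c.valid hxy
  have h2 := c.valid hxz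
  have h3 := c.valid hyz
  omega

theorem fanTwo_colorable_three : fanTwo.Colorable 3 := by
  refine ⟨SimpleGraph.Coloring.mk ![0, 1, 2, 1, 2] ?_⟩
  intro i j hij
  rw [fanTwo_adj_iff] at hij
  revert i j
  decide

theorem three_le_chromaticNumber {V : Type*} {G : SimpleGraph V} (h : ¬ G.Colorable 2) :
    3 ≤ G.chromaticNumber := by
  by_contra hlt
  refine h (SimpleGraph.chromaticNumber_le_iff_colorable.1 ?_)
  have h3 : (3 : ℕ∞) = 2 + 1 := by norm_num
  rw [not_le, h3] at hlt
  exact Order.le_of_lt_add_one hlt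

theorem fanTwo_chromaticNumber : fanTwo.chromaticNumber = (3 : ℕ) :=
  le_antisymm fanTwo_colorable_three.chromaticNumber_le <| three_le_chromaticNumber <|
    not_colorable_two_of_triangle (x := 0) (y := 1) (z := 2) (by simp [fanTwo_adj_iff])
      (by simp [fanTwo_adj_iff]) (by simp [fanTwo_adj_iff])

/-- The two triangles are edge-disjoint, so one of them survives any single deletion. -/
theorem fanTwo_not_isColorCritical (e : Sym2 (Fin 5)) : ¬ IsColorCritical fanTwo e := by
  rintro ⟨-, h⟩
  rw [fanTwo_chromaticNumber] at h
  refine absurd (three_le_chromaticNumber ?_) (not_le.2 h)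
  by_cases he : e = s(0, 1) ∨ e = s(0, 2) ∨ e = s(1, 2)
  · refine not_colorable_two_of_triangle (x := 0) (y := 3) (z := 4) ?_ ?_ ?_ <;>
    · rw [SimpleGraph.deleteEdges_adj, fanTwo_adj_iff, Set.mem_singleton_iff]
      rcases he with rfl | rfl | rfl <;> decide
  · push Not at he
    refine not_colorable_two_of_triangle (x := 0) (y := 1) (z := 2) ?_ ?_ ?_ <;>
    · rw [SimpleGraph.deleteEdges_adj, fanTwo_adj_iff, Set.mem_singleton_iff]
      exact ⟨by decide, fun h => by simp_all⟩

theorem fanTwo_free_cycleGraph_four : fanTwo.Free (SimpleGraph.cycleGraph 4) := by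
  rintro ⟨f⟩
  simpa using Fintype.card_le_of_injective f f.injective

theorem turanGraph_two_colorable (n : ℕ) : (SimpleGraph.turanGraph n 2).Colorable 2 := by
  refine ⟨SimpleGraph.Coloring.mk (fun v => ⟨v % 2, Nat.mod_lt _ two_pos⟩) ?_⟩
  intro u v h h'
  exact h (congrArg Fin.val h')

theorem fanTwo_free_turanGraph_two (n : ℕ) : fanTwo.Free (SimpleGraph.turanGraph n 2) := by
  rintro ⟨f⟩
  refine not_colorable_two_of_triangle (G := fanTwo) (x := 0) (y := 1) (z := 2)
    (by simp [fanTwo_adj_iff]) (by simp [fanTwo_adj_iff]) (by simp [fanTwo_adj_iff]) ?_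
  exact (turanGraph_two_colorable n).of_hom f.toHom

/-! ### Four-cycles in the balanced complete bipartite graph -/

theorem card_filter_even (n : ℕ) : #{v : Fin n | (v : ℕ) % 2 = 0} = (n + 1) / 2 := by
  rw [Finset.card_filter, Fin.sum_univ_eq_sum_range (fun v => if v % 2 = 0 then 1 else 0) n]
  induction n with
  | zero => rfl
  | succ n ih => rw [Finset.sum_range_succ, ih]; split_ifs <;> omega

theorem card_filter_odd (n : ℕ) : #{v : Fin n | (v : ℕ) % 2 = 1} = n / 2 := by
  rw [Finset.card_filter, Fin.sum_univ_eq_sum_range (fun v => if v % 2 = 1 then 1 else 0) n]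
  induction n with
  | zero => rfl
  | succ n ih => rw [Finset.sum_range_succ, ih]; split_ifs <;> omega

theorem le_labelledCopyCount_of_complete_bipartite {V : Type*} [Fintype V] [DecidableEq V]
    {G : SimpleGraph V} {A B : Finset V} (hAB : Disjoint A B)
    (h : ∀ a ∈ A, ∀ b ∈ B, G.Adj a b) :
    2 * (#A * #B * ((#A - 1) * (#B - 1))) ≤
      G.labelledCopyCount (SimpleGraph.cycleGraph 4) := by
  have hsq : ∀ S T : Finset V, (∀ a ∈ S, ∀ b ∈ T, G.Adj a b) → ∀ p ∈ S ×ˢ T,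
      (#S - 1) * (#T - 1) ≤ #(squarePairs G p.1 p.2) := by
    rintro S T hST ⟨u, v⟩ hp
    obtain ⟨hu, hv⟩ := Finset.mem_product.1 hp
    rw [mul_comm, ← Finset.card_erase_of_mem hu, ← Finset.card_erase_of_mem hv,
      ← Finset.card_product]
    refine Finset.card_le_card ?_
    rintro ⟨b, a⟩ hba
    simp only [Finset.mem_product, Finset.mem_erase] at hba
    obtain ⟨⟨hbv, hb⟩, hau, ha⟩ := hba
    rw [mem_squarePairs]
    exact ⟨hST _ hu _ hb, (hST _ ha _ hb).symm, hST _ ha _ hv, hbv, hau⟩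
  have h' : ∀ b ∈ B, ∀ a ∈ A, G.Adj b a := fun b hb a ha => (h a ha b hb).symm
  rw [labelledCopyCount_cycleGraph_four]
  have hdisj : Disjoint (A ×ˢ B) (B ×ˢ A) :=
    Finset.disjoint_product.2 (Or.inl hAB)
  have hsub : A ×ˢ B ∪ B ×ˢ A ⊆ adjPairs G := by
    rintro ⟨u, v⟩ hp
    rw [mem_adjPairs]
    rcases Finset.mem_union.1 hp with hp | hp <;> obtain ⟨hu, hv⟩ := Finset.mem_product.1 hp
    exacts [h _ hu _ hv, h' _ hu _ hv]
  refine le_trans ?_ (Finset.sum_le_sum_of_subset hsub)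
  rw [Finset.sum_union hdisj]
  have h1 := Finset.card_nsmul_le_sum _ _ _ (hsq A B h)
  have h2 := Finset.card_nsmul_le_sum _ _ _ (hsq B A h')
  rw [Finset.card_product, smul_eq_mul] at h1 h2
  nlinarith

theorem le_labelledCopyCount_turanGraph_two (n : ℕ) :
    2 * ((n + 1) / 2 * (n / 2) * (((n + 1) / 2 - 1) * (n / 2 - 1))) ≤
      (SimpleGraph.turanGraph n 2).labelledCopyCount (SimpleGraph.cycleGraph 4) := by
  rw [← card_filter_even, ← card_filter_odd]
  refine le_labelledCopyCount_of_complete_bipartite ?_ ?_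
  · refine Finset.disjoint_filter.2 fun v _ h => by omega
  · intro a ha b hb
    rw [Finset.mem_filter] at ha hb
    rw [SimpleGraph.turanGraph_adj, ha.2, hb.2]
    decide

/-! ### Squares through a single edge -/

theorem mul_le_half_mul_half {x y m : ℕ} (h : x + y ≤ m) : x * y ≤ (m + 1) / 2 * (m / 2) := by
  obtain ⟨k, rfl | rfl⟩ := Nat.even_or_odd' m
  · rw [show (2 * k + 1) / 2 = k by omega, show 2 * k / 2 = k by omega]
    nlinarith [Nat.mul_le_mul h h, sq_nonneg ((x : ℤ) - y), four_mul_le_sq_add x y]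
  · rw [show (2 * k + 1 + 1) / 2 = k + 1 by omega, show (2 * k + 1) / 2 = k by omega]
    rcases le_total x k with hx | hx
    · obtain ⟨j, rfl⟩ := Nat.exists_eq_add_of_le hx
      have : y ≤ x + 2 * j + 1 := by omega
      nlinarith [Nat.mul_le_mul_left x this]
    · rcases hx.eq_or_lt with rfl | hx
      · have : y ≤ k + 1 := by omega
        nlinarith [Nat.mul_le_mul_left k this]
      · obtain ⟨j, rfl⟩ := Nat.exists_eq_add_of_le (Nat.succ_le_of_lt hx)
        have : y + j ≤ k := by omega
        nlinarith [Nat.mul_le_mul_left (k + 1 + j) this]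

/-- `P` lies in the product of its two projections, which are disjoint subsets of the complement of
`Z`. -/
theorem card_le_half_mul_half_of_avoiding {V : Type*} [Fintype V] [DecidableEq V]
    {P : Finset (V × V)} {Z : Finset V} (hP : ∀ p ∈ P, ∀ q ∈ P, p.1 ≠ q.2)
    (hZ : ∀ p ∈ P, p.1 ∉ Z ∧ p.2 ∉ Z) :
    #P ≤ (Fintype.card V - #Z + 1) / 2 * ((Fintype.card V - #Z) / 2) := by
  have hsub : P ⊆ P.image Prod.fst ×ˢ P.image Prod.snd := fun p hp =>
    Finset.mem_product.2 ⟨Finset.mem_image_of_mem _ hp, Finset.mem_image_of_mem _ hp⟩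
  refine (Finset.card_le_card hsub).trans ?_
  rw [Finset.card_product]
  refine mul_le_half_mul_half ?_
  have hdisj : Disjoint (P.image Prod.fst) (P.image Prod.snd) := by
    rw [Finset.disjoint_left]
    intro a ha hb
    obtain ⟨p, hp, rfl⟩ := Finset.mem_image.1 ha
    obtain ⟨q, hq, h⟩ := Finset.mem_image.1 hb
    exact hP p hp q hq h.symm
  rw [← Finset.card_union_of_disjoint hdisj, ← Finset.card_compl]
  refine Finset.card_le_card ?_
  intro a ha
  rw [Finset.mem_compl]
  rcases Finset.mem_union.1 ha with ha | ha <;> obtain ⟨p, hp, rfl⟩ := Finset.mem_image.1 ha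
  exacts [(hZ p hp).1, (hZ p hp).2]

/-- If no vertex occurs both as an `a` and as a `b`, the pairs `(a, b)` lie in a product of disjoint
sets avoiding `u` and `v`, which gives the bound. A repeated vertex forces a bowtie or a `K₄` on
`uv`. In the `K₄` case all pairs but two avoid the whole clique, and the two exceptions cost less
than is gained by removing two more vertices. -/
theorem card_squarePairs_le {V : Type*} [Fintype V] {G : SimpleGraph V} (hG : BowtieFree G)
    (hV : 6 ≤ Fintype.card V) {u v : V} (huv : G.Adj u v) :
    #(squarePairs G u v) ≤
      ((Fintype.card V + 1) / 2 - 1) * (Fintype.card V / 2 - 1) := by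
  classical
  by_cases hK : ∃ c d, G.Adj u c ∧ G.Adj v c ∧ G.Adj u d ∧ G.Adj v d ∧ G.Adj c d
  · obtain ⟨c, d, huc, hvc, hud, hvd, hcd⟩ := hK
    have hsplit := Finset.card_le_card_sdiff_add_card
      (s := squarePairs G u v) (t := {(c, d), (d, c)})
    have hpair : #({(c, d), (d, c)} : Finset (V × V)) ≤ 2 := Finset.card_le_two
    have hZ : #({u, v, c, d} : Finset V) = 4 := by
      rw [Finset.card_insert_of_notMem, Finset.card_insert_of_notMem, Finset.card_pair hcd.ne]
      · simp [hvc.ne, hvd.ne]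
      · simp [huv.ne, huc.ne, hud.ne]
    have havoid : ∀ p ∈ squarePairs G u v \ {(c, d), (d, c)},
        p.1 ∉ ({u, v, c, d} : Finset V) ∧ p.2 ∉ ({u, v, c, d} : Finset V) := by
      rintro ⟨a, b⟩ hp
      simp only [Finset.mem_sdiff, mem_squarePairs, Finset.mem_insert, Finset.mem_singleton,
        Prod.mk.injEq, not_or] at hp ⊢
      obtain ⟨⟨h1, h2, h3, h4, h5⟩, h6, h7⟩ := hp
      refine ⟨⟨h1.ne', h4, ?_, ?_⟩, h5, h3.ne, ?_, ?_⟩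
      · rintro rfl
        exact hG hvc h3.symm huv.symm hvd h2 hud huc.ne' hcd.ne h5 fun h => h6 ⟨rfl, h⟩
      · rintro rfl
        exact hG hvd h3.symm huv.symm hvc h2 huc hud.ne' hcd.ne' h5 fun h => h7 ⟨rfl, h⟩
      · rintro rfl
        exact hG huc h1 huv hud h2.symm hvd hvc.ne' hcd.ne h4 fun h => h7 ⟨h, rfl⟩
      · rintro rfl
        exact hG hud h1 huv huc h2.symm hvc hvd.ne' hcd.ne' h4 fun h => h6 ⟨h, rfl⟩
    have hmain := card_le_half_mul_half_of_avoiding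
      (P := squarePairs G u v \ {(c, d), (d, c)}) (Z := {u, v, c, d}) ?_ havoid
    · rw [hZ] at hmain
      have hnum : (Fintype.card V - 4 + 1) / 2 * ((Fintype.card V - 4) / 2) + 2 ≤
          ((Fintype.card V + 1) / 2 - 1) * (Fintype.card V / 2 - 1) := by
        obtain ⟨k, hk⟩ := Nat.exists_eq_add_of_le hV
        rw [hk, show (6 + k - 4 + 1) / 2 = (k + 1) / 2 + 1 by omega,
          show (6 + k - 4) / 2 = k / 2 + 1 by omega,
          show (6 + k + 1) / 2 - 1 = (k + 1) / 2 + 2 by omega,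
          show (6 + k) / 2 - 1 = k / 2 + 2 by omega]
        generalize (k + 1) / 2 = x
        generalize k / 2 = y
        nlinarith
      omega
    · intro p hp q hq h
      have hp' := mem_squarePairs.1 (Finset.mem_sdiff.1 hp).1
      have hq' := mem_squarePairs.1 (Finset.mem_sdiff.1 hq).1
      have hz := (havoid p hp).1
      simp only [Finset.mem_insert, Finset.mem_singleton, not_or] at hz
      exact hG huv hp'.1 huc hud (h ▸ hq'.2.2.1.symm) hcd hvc.ne hvd.ne hz.2.2.1 hz.2.2.2
  · have hmain := card_le_half_mul_half_of_avoiding (P := squarePairs G u v) (Z := {u, v}) ?_ ?_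
    · rw [Finset.card_pair huv.ne] at hmain
      rwa [show (Fintype.card V - 2 + 1) / 2 = (Fintype.card V + 1) / 2 - 1 by omega,
        show (Fintype.card V - 2) / 2 = Fintype.card V / 2 - 1 by omega] at hmain
    · rintro ⟨a, b⟩ hp ⟨a', b'⟩ hq h
      simp only [mem_squarePairs] at hp hq h
      obtain ⟨h1, h2, h3, h4, h5⟩ := hp
      obtain ⟨h1', h2', h3', h4', h5'⟩ := hq
      subst h
      -- The repeated vertex `a` is adjacent to `u` and `v`. If `b = a'`, then `u, v, a, b` is a
      -- `K₄`; if not, the triangles `a b v` and `a a' u` form a bowtie.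
      by_cases hb : b = a'
      · subst hb
        exact hK ⟨a, b, h1, h3'.symm, h1', h3.symm, h2⟩
      · exact hG h2 h3' h2'.symm h1.symm h3 h1'.symm hb h5 h4'.symm huv.ne'
    · rintro ⟨a, b⟩ hp
      simp only [mem_squarePairs, Finset.mem_insert, Finset.mem_singleton, not_or] at hp ⊢
      obtain ⟨h1, h2, h3, h4, h5⟩ := hp
      exact ⟨⟨h1.ne', h4⟩, h5, h3.ne⟩

/-! ### Edge counts in triangle-free graphs -/

section
variable {V : Type*} {G : SimpleGraph V}

open scoped Classical in
/-- The number of neighbours of `x` in `S`. -/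
noncomputable def nbrCount (G : SimpleGraph V) (S : Finset V) (x : V) : ℕ :=
  #{y ∈ S | G.Adj x y}

theorem nbrCount_le_card (S : Finset V) (x : V) : nbrCount G S x ≤ #S := by
  classical exact Finset.card_filter_le _ _

theorem nbrCount_le_one {S : Finset V} {x : V}
    (h : ∀ a ∈ S, ∀ b ∈ S, G.Adj x a → G.Adj x b → a = b) : nbrCount G S x ≤ 1 := by
  classical
  refine Finset.card_le_one.2 fun a ha b hb => ?_
  rw [Finset.mem_filter] at ha hb
  exact h a ha.1 b hb.1 ha.2 hb.2

theorem nbrCount_singleton_le_one (x y : V) : nbrCount G {y} x ≤ 1 :=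
  nbrCount_le_card _ _

theorem nbrCount_singleton_eq_zero {x y : V} (h : ¬ G.Adj x y) : nbrCount G {y} x = 0 := by
  simp [nbrCount, Finset.filter_singleton, h]

theorem nbrCount_insert [DecidableEq V] {S : Finset V} {y : V} (hy : y ∉ S) (x : V) :
    nbrCount G (insert y S) x = nbrCount G {y} x + nbrCount G S x := by
  classical
  simp only [nbrCount, Finset.card_filter, Finset.sum_insert hy, Finset.sum_singleton]

theorem nbrCount_add_nbrCount_le_one {w x y : V} (h : ¬ (G.Adj w x ∧ G.Adj w y)) :
    nbrCount G {x} w + nbrCount G {y} w ≤ 1 := by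
  have hx := nbrCount_singleton_le_one (G := G) w x
  have hy := nbrCount_singleton_le_one (G := G) w y
  rcases not_and_or.1 h with h | h
  · rw [nbrCount_singleton_eq_zero h]
    omega
  · rw [nbrCount_singleton_eq_zero h]
    omega

/-- The number of pairs in `S × T` that are adjacent. -/
noncomputable def adjCount (G : SimpleGraph V) (S T : Finset V) : ℕ :=
  ∑ x ∈ S, nbrCount G T x

theorem adjCount_comm (S T : Finset V) : adjCount G S T = adjCount G T S := by
  classical
  simp only [adjCount, nbrCount, Finset.card_filter]
  rw [Finset.sum_comm]
  simp only [G.adj_comm]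

theorem adjCount_union_left [DecidableEq V] {S T U : Finset V} (h : Disjoint S T) :
    adjCount G (S ∪ T) U = adjCount G S U + adjCount G T U :=
  Finset.sum_union h

theorem adjCount_union_right [DecidableEq V] {S T U : Finset V} (h : Disjoint S T) :
    adjCount G U (S ∪ T) = adjCount G U S + adjCount G U T := by
  rw [adjCount_comm, adjCount_union_left h, adjCount_comm S, adjCount_comm T]

theorem adjCount_le {S T : Finset V} {k : ℕ} (h : ∀ x ∈ S, nbrCount G T x ≤ k) :
    adjCount G S T ≤ #S * k :=
  Finset.sum_le_card_nsmul _ _ _ h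

theorem card_adjPairs [Fintype V] : #(adjPairs G) = adjCount G univ univ := by
  classical
  rw [adjPairs, adjCount, Finset.card_filter, ← Finset.univ_product_univ, Finset.sum_product]
  simp only [nbrCount, Finset.card_filter]

/-- Mantel's theorem for the subgraph induced on `W`. -/
theorem two_mul_adjCount_le_sq
    (hG : ∀ ⦃x y z : V⦄, G.Adj x y → G.Adj x z → G.Adj y z → False) (W : Finset V) :
    2 * adjCount G W W ≤ #W ^ 2 := by
  classical
  rcases W.eq_empty_or_nonempty with rfl | hW
  · simp [adjCount]
  obtain ⟨x, hx, hmax⟩ := Finset.exists_max_image W (nbrCount G W) hW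
  -- `N` is independent, so every edge in `W` meets `W \ N`, where degrees are at most `#N`; the
  -- final step is `4st ≤ (s + t)²`.
  set N := {y ∈ W | G.Adj x y} with hN
  have hNW : N ⊆ W := Finset.filter_subset _ _
  have hNN : adjCount G N N = 0 := by
    refine Finset.sum_eq_zero fun y hy => ?_
    rw [nbrCount, Finset.card_eq_zero, Finset.filter_eq_empty_iff]
    intro z hz hyz
    exact hG (Finset.mem_filter.1 hy).2 (Finset.mem_filter.1 hz).2 hyz
  have hdisj : Disjoint N (W \ N) := Finset.disjoint_sdiff
  have hunion : N ∪ W \ N = W := Finset.union_sdiff_of_subset hNW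
  have hcard : #N + #(W \ N) = #W := by rw [← Finset.card_union_of_disjoint hdisj, hunion]
  have hle : adjCount G (W \ N) W ≤ #(W \ N) * #N :=
    adjCount_le fun y hy => hmax y (Finset.mem_sdiff.1 hy).1
  have h1 : adjCount G W W = adjCount G N W + adjCount G (W \ N) W := by
    rw [← adjCount_union_left hdisj, hunion]
  have h2 : adjCount G N W = adjCount G N N + adjCount G N (W \ N) := by
    rw [← adjCount_union_right hdisj, hunion]
  have h3 : adjCount G N (W \ N) ≤ adjCount G (W \ N) W := by
    rw [adjCount_comm]
    exact Finset.sum_le_sum fun y _ => Finset.card_le_card (Finset.filter_subset_filter _ hNW)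
  rw [← hcard]
  nlinarith [four_mul_le_sq_add #N #(W \ N)]

/-- Mantel is applied outside `S` only. A small `S` that sends few edges outwards thus yields an
explicit deficit from `n²/4`. -/
theorem two_mul_card_adjPairs_le [Fintype V]
    (hG : ∀ ⦃x y z : V⦄, G.Adj x y → G.Adj x z → G.Adj y z → False) {S : Finset V} {j k m : ℕ}
    (hm : #S + m = Fintype.card V)
    (hin : ∀ w ∈ S, nbrCount G S w ≤ j) (hout : ∀ w ∉ S, nbrCount G S w ≤ k) :
    2 * #(adjPairs G) ≤ 2 * (#S * j) + 4 * (m * k) + m ^ 2 := by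
  classical
  have hm' : #Sᶜ = m := by rw [Finset.card_compl]; omega
  have h1 : adjCount G S S ≤ #S * j := adjCount_le hin
  have h2 : adjCount G Sᶜ S ≤ #Sᶜ * k := adjCount_le fun w hw => hout w (Finset.mem_compl.1 hw)
  have h3 := two_mul_adjCount_le_sq hG Sᶜ
  have hdisj : Disjoint S Sᶜ := disjoint_compl_right
  have h4 : #(adjPairs G) = adjCount G S S + 2 * adjCount G Sᶜ S + adjCount G Sᶜ Sᶜ := by
    rw [card_adjPairs, ← Finset.union_compl S, adjCount_union_left hdisj,
      adjCount_union_right hdisj, adjCount_union_right hdisj, adjCount_comm S Sᶜ]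
    ring
  rw [hm'] at h2 h3
  omega

end

/-! ### How triangles meet in a bowtie-free graph -/

section
variable {V : Type*} [DecidableEq V] {G : SimpleGraph V}

theorem exists_of_mem_isNClique_three {S : Finset V} (hS : G.IsNClique 3 S) {p : V}
    (hp : p ∈ S) : ∃ s t, G.Adj p s ∧ G.Adj p t ∧ G.Adj s t ∧ S = {p, s, t} := by
  obtain ⟨a, b, c, hab, hac, hbc, rfl⟩ := SimpleGraph.is3Clique_iff.1 hS
  simp only [Finset.mem_insert, Finset.mem_singleton] at hp
  rcases hp with rfl | rfl | rfl
  · exact ⟨b, c, hab, hac, hbc, rfl⟩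
  · exact ⟨a, c, hab.symm, hbc, hac, Finset.insert_comm _ _ _⟩
  · exact ⟨a, b, hac.symm, hbc.symm, hab, by grind⟩

theorem exists_of_mem_mem_isNClique_three {S : Finset V} (hS : G.IsNClique 3 S) {p q : V}
    (hp : p ∈ S) (hq : q ∈ S) (hpq : p ≠ q) :
    ∃ s ∈ S, G.Adj p q ∧ G.Adj p s ∧ G.Adj q s := by
  obtain ⟨s, t, hps, hpt, hst, rfl⟩ := exists_of_mem_isNClique_three hS hp
  simp only [Finset.mem_insert, Finset.mem_singleton] at hq
  rcases hq with rfl | rfl | rfl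
  · exact absurd rfl hpq
  · exact ⟨t, by simp, hps, hpt, hst⟩
  · exact ⟨s, by simp, hpt, hps, hst.symm⟩

theorem BowtieFree.two_mem_of_not_disjoint (hG : BowtieFree G) {x y z : V} (hxy : G.Adj x y)
    (hxz : G.Adj x z) (hyz : G.Adj y z) {S : Finset V} (hS : G.IsNClique 3 S)
    (h : ¬ Disjoint S {x, y, z}) :
    (x ∈ S ∧ y ∈ S) ∨ (x ∈ S ∧ z ∈ S) ∨ (y ∈ S ∧ z ∈ S) := by
  obtain ⟨p, hpS, hp⟩ := Finset.not_disjoint_iff.1 h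
  obtain ⟨s, t, hps, hpt, hst, rfl⟩ := exists_of_mem_isNClique_three hS hpS
  simp only [Finset.mem_insert, Finset.mem_singleton] at hp ⊢
  by_contra hcon
  rcases hp with rfl | rfl | rfl
  · exact hG hps hpt hxy hxz hst hyz (by grind) (by grind) (by grind) (by grind)
  · exact hG hps hpt hxy.symm hyz hst hxz (by grind) (by grind) (by grind) (by grind)
  · exact hG hps hpt hxz.symm hyz.symm hst hxy (by grind) (by grind) (by grind) (by grind)

/-- Every triangle meeting a triangle of a `K₄` contains one of two opposite edges of it. -/
theorem BowtieFree.mem_opposite_edge_of_not_disjoint (hG : BowtieFree G) {x y z w : V}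
    (hxy : G.Adj x y) (hxz : G.Adj x z) (hyz : G.Adj y z) (hxw : G.Adj x w) (hyw : G.Adj y w)
    (hzw : G.Adj z w) {S : Finset V} (hS : G.IsNClique 3 S) (h : ¬ Disjoint S {x, y, z}) :
    (x ∈ S ∧ y ∈ S) ∨ (z ∈ S ∧ w ∈ S) := by
  rcases hG.two_mem_of_not_disjoint hxy hxz hyz hS h with h | ⟨hx, hz⟩ | ⟨hy, hz⟩
  · exact Or.inl h
  · obtain ⟨s, hs, -, hxs, hzs⟩ := exists_of_mem_mem_isNClique_three hS hx hz hxz.ne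
    by_cases hsy : s = y
    · exact Or.inl ⟨hx, hsy ▸ hs⟩
    by_cases hsw : s = w
    · exact Or.inr ⟨hz, hsw ▸ hs⟩
    exact (hG hxz hxs hxy hxw hzs hyw hyz.ne' hzw.ne hsy hsw).elim
  · obtain ⟨s, hs, -, hys, hzs⟩ := exists_of_mem_mem_isNClique_three hS hy hz hyz.ne
    by_cases hsx : s = x
    · exact Or.inl ⟨hsx ▸ hs, hy⟩
    by_cases hsw : s = w
    · exact Or.inr ⟨hz, hsw ▸ hs⟩
    exact (hG hyz hys hxy.symm hyw hzs hxw hxz.ne' hzw.ne hsx hsw).elim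

/-- A triangle `u c s` with `s ≠ v` would form a bowtie with `u v d`: here `s ≠ d` because `c` and
`d` are not adjacent. The same holds with `u` and `v` exchanged. -/
theorem BowtieFree.mem_of_two_common (hG : BowtieFree G) {u v c d : V}
    (huv : G.Adj u v) (huc : G.Adj u c) (hvc : G.Adj v c) (hud : G.Adj u d) (hvd : G.Adj v d)
    (hcd : c ≠ d) (hcd' : ¬ G.Adj c d) {S : Finset V} (hS : G.IsNClique 3 S)
    (h : ¬ Disjoint S {u, v, c}) : u ∈ S ∧ v ∈ S := by
  rcases hG.two_mem_of_not_disjoint huv huc hvc hS h with h | ⟨hu, hc⟩ | ⟨hv, hc⟩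
  · exact h
  · obtain ⟨s, hs, -, hus, hcs⟩ := exists_of_mem_mem_isNClique_three hS hu hc huc.ne
    by_cases hsv : s = v
    · exact ⟨hu, hsv ▸ hs⟩
    exact (hG huc hus huv hud hcs hvd hvc.ne' hcd hsv fun h => hcd' (h ▸ hcs)).elim
  · obtain ⟨s, hs, -, hvs, hcs⟩ := exists_of_mem_mem_isNClique_three hS hv hc hvc.ne
    by_cases hsu : s = u
    · exact ⟨hsu ▸ hs, hv⟩
    exact (hG hvc hvs huv.symm hvd hcs hud huc.ne' hcd hsu fun h => hcd' (h ▸ hcs)).elim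

/-- A triangle outside every `K₄` has an edge lying in all the triangles that meet it. -/
theorem BowtieFree.exists_edge_mem_of_not_disjoint (hG : BowtieFree G) {T : Finset V}
    (hT : G.IsNClique 3 T) (hK : ∀ w, ¬ ∀ x ∈ T, G.Adj x w) :
    ∃ u v c, G.Adj u v ∧ G.Adj u c ∧ G.Adj v c ∧ T = {u, v, c} ∧
      ∀ S, G.IsNClique 3 S → ¬ Disjoint S T → u ∈ S ∧ v ∈ S := by
  -- If some edge of `T` has a second common neighbour, that edge works. Otherwise only `T` itself
  -- meets `T`, and any edge will do.
  by_cases h : ∃ u v c d, G.Adj u v ∧ G.Adj u c ∧ G.Adj v c ∧ T = {u, v, c} ∧ G.Adj u d ∧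
      G.Adj v d ∧ c ≠ d
  · obtain ⟨u, v, c, d, huv, huc, hvc, rfl, hud, hvd, hcd⟩ := h
    refine ⟨u, v, c, huv, huc, hvc, rfl, fun S hS hST =>
      hG.mem_of_two_common huv huc hvc hud hvd hcd (fun hadj => hK d ?_) hS hST⟩
    simp [hud, hvd, hadj]
  · obtain ⟨x, y, z, hxy, hxz, hyz, rfl⟩ := SimpleGraph.is3Clique_iff.1 hT
    refine ⟨x, y, z, hxy, hxz, hyz, rfl, fun S hS hST => ?_⟩
    rcases hG.two_mem_of_not_disjoint hxy hxz hyz hS hST with h' | ⟨hx, hz⟩ | ⟨hy, hz⟩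
    · exact h'
    · obtain ⟨s, hs, -, hxs, hzs⟩ := exists_of_mem_mem_isNClique_three hS hx hz hxz.ne
      by_cases hsy : s = y
      · exact ⟨hx, hsy ▸ hs⟩
      exact (h ⟨x, z, y, s, hxz, hxy, hyz.symm, by grind, hxs, hzs, Ne.symm hsy⟩).elim
    · obtain ⟨s, hs, -, hys, hzs⟩ := exists_of_mem_mem_isNClique_three hS hy hz hyz.ne
      by_cases hsx : s = x
      · exact ⟨hsx ▸ hs, hy⟩
      exact (h ⟨y, z, x, s, hyz, hxy.symm, hxz.symm, by grind, hys, hzs, Ne.symm hsx⟩).elim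

/-! ### Triangle packings and deletion of edges -/

theorem exists_maximal_disjoint_triangles [Fintype V] (G : SimpleGraph V) :
    ∃ 𝒯 : Finset (Finset V), (∀ T ∈ 𝒯, G.IsNClique 3 T) ∧
      (𝒯 : Set (Finset V)).PairwiseDisjoint id ∧ 3 * #𝒯 ≤ Fintype.card V ∧
      ∀ S, G.IsNClique 3 S → ∃ T ∈ 𝒯, ¬ Disjoint S T := by
  classical
  let P : Finset (Finset V) → Prop := fun 𝒯 => (∀ T ∈ 𝒯, G.IsNClique 3 T) ∧
    (𝒯 : Set (Finset V)).PairwiseDisjoint id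
  obtain ⟨𝒯, h𝒯, hmax⟩ := Finset.exists_max_image (univ.filter P) Finset.card
    ⟨∅, by simp [P]⟩
  obtain ⟨htri, hdisj⟩ : P 𝒯 := (Finset.mem_filter.1 h𝒯).2
  refine ⟨𝒯, htri, hdisj, ?_, ?_⟩
  · have hcard : #(𝒯.biUnion id) = #𝒯 * 3 := by
      rw [Finset.card_biUnion hdisj]
      exact Finset.sum_const_nat fun T hT => (htri T hT).card_eq
    have := Finset.card_le_univ (𝒯.biUnion id)
    omega
  · intro S hS
    by_contra! hcon
    have hS𝒯 : S ∉ 𝒯 := fun hmem => by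
      have := hcon S hmem
      rw [disjoint_self] at this
      have h3 := hS.card_eq
      simp [this] at h3
    have hP : P (insert S 𝒯) := by
      refine ⟨fun T hT => ?_, ?_⟩
      · rcases Finset.mem_insert.1 hT with rfl | hT
        exacts [hS, htri T hT]
      · rw [Finset.coe_insert]
        exact hdisj.insert fun T hT _ => hcon T hT
    have := hmax _ (Finset.mem_filter.2 ⟨Finset.mem_univ _, hP⟩)
    rw [Finset.card_insert_of_notMem hS𝒯] at this
    omega

theorem triangleFree_deleteEdges {R : Set (Sym2 V)}
    (h : ∀ S, G.IsNClique 3 S → ∃ u v, u ∈ S ∧ v ∈ S ∧ u ≠ v ∧ s(u, v) ∈ R) ⦃x y z : V⦄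
    (hxy : (G.deleteEdges R).Adj x y) (hxz : (G.deleteEdges R).Adj x z)
    (hyz : (G.deleteEdges R).Adj y z) : False := by
  obtain ⟨u, v, hu, hv, huv, hR⟩ := h {x, y, z} (SimpleGraph.is3Clique_iff.2
    ⟨x, y, z, G.deleteEdges_le R hxy, G.deleteEdges_le R hxz, G.deleteEdges_le R hyz, rfl⟩)
  have hadj : (G.deleteEdges R).Adj u v := by
    have hxy' := hxy.symm
    have hxz' := hxz.symm
    have hyz' := hyz.symm
    simp only [Finset.mem_insert, Finset.mem_singleton] at hu hv
    rcases hu with rfl | rfl | rfl <;> rcases hv with rfl | rfl | rfl <;>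
      first | assumption | exact absurd rfl huv
  exact (SimpleGraph.deleteEdges_adj.1 hadj).2 hR

open scoped Classical in
theorem card_filter_mk_mem_le [Fintype V] (R : Finset (Sym2 V)) :
    #{p : V × V | s(p.1, p.2) ∈ R} ≤ 2 * #R := by
  refine Finset.card_le_mul_card_image_of_maps_to (f := fun p : V × V => s(p.1, p.2)) ?_ 2 ?_
  · intro p hp
    exact (Finset.mem_filter.1 hp).2
  · intro e he
    induction e with
    | _ x y =>
      refine (Finset.card_le_card (t := {(x, y), (y, x)}) ?_).trans Finset.card_le_two
      rintro ⟨a, b⟩ hab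
      have := (Finset.mem_filter.1 hab).2
      simpa using this

theorem card_adjPairs_le_deleteEdges [Fintype V] (R : Finset (Sym2 V)) :
    #(adjPairs G) ≤ #(adjPairs (G.deleteEdges (R : Set (Sym2 V)))) + 2 * #R := by
  classical
  refine le_trans ?_ (Nat.add_le_add_left (card_filter_mk_mem_le R) _)
  refine le_trans (Finset.card_le_card ?_) (Finset.card_union_le _ _)
  intro p hp
  rw [mem_adjPairs] at hp
  by_cases hR : s(p.1, p.2) ∈ R <;> simp [SimpleGraph.deleteEdges_adj, hp, hR]

end

/-! ### Configurations that force few edges -/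

section
variable {V : Type*} [Fintype V] {G : SimpleGraph V}

/-- A four-clique in a bowtie-free graph pushes the number of edges below `n² / 4`. -/
theorem BowtieFree.two_mul_card_adjPairs_le_of_four_clique (hG : BowtieFree G) {x y z w : V}
    (hxy : G.Adj x y) (hxz : G.Adj x z) (hyz : G.Adj y z) (hxw : G.Adj x w) (hyw : G.Adj y w)
    (hzw : G.Adj z w) (hV : 30 ≤ Fintype.card V) :
    2 * #(adjPairs G) ≤ Fintype.card V ^ 2 := by
  classical
  obtain ⟨𝒯, htri, -, hcard, hmeet⟩ := exists_maximal_disjoint_triangles G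
  -- `ρ T` hits all triangles meeting `T`: two opposite edges of a `K₄` containing `T`, or a single
  -- edge when there is none. The empty set is a dummy value for non-triangles.
  have hρ : ∀ T : Finset V, ∃ ρ : Finset (Sym2 V), G.IsNClique 3 T → #ρ ≤ 2 ∧
      ∀ S, G.IsNClique 3 S → ¬ Disjoint S T → ∃ u v, u ∈ S ∧ v ∈ S ∧ u ≠ v ∧ s(u, v) ∈ ρ := by
    intro T
    by_cases hT : G.IsNClique 3 T
    · by_cases hK : ∃ d, ∀ x ∈ T, G.Adj x d
      · obtain ⟨d, hd⟩ := hK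
        obtain ⟨a, b, c, hab, hac, hbc, rfl⟩ := SimpleGraph.is3Clique_iff.1 hT
        have hcd := hd c (by simp)
        refine ⟨{s(a, b), s(c, d)}, fun _ => ⟨Finset.card_le_two, fun S hS hST => ?_⟩⟩
        rcases hG.mem_opposite_edge_of_not_disjoint hab hac hbc (hd a (by simp))
          (hd b (by simp)) hcd hS hST with ⟨ha, hb⟩ | ⟨hc, hd⟩
        · exact ⟨a, b, ha, hb, hab.ne, by simp⟩
        · exact ⟨c, d, hc, hd, hcd.ne, by simp⟩
      · obtain ⟨u, v, c, huv, -, -, -, h⟩ :=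
          hG.exists_edge_mem_of_not_disjoint hT (not_exists.1 hK)
        exact ⟨{s(u, v)}, fun _ => ⟨by simp, fun S hS hST =>
          ⟨u, v, (h S hS hST).1, (h S hS hST).2, huv.ne, by simp⟩⟩⟩
    · exact ⟨∅, fun h => absurd h hT⟩
  choose ρ hρ using hρ
  set R := 𝒯.biUnion ρ with hR
  have hRcard : #R ≤ #𝒯 * 2 := Finset.card_biUnion_le_card_mul _ _ _ fun T hT =>
    (hρ T (htri T hT)).1
  have hfree := triangleFree_deleteEdges (G := G) (R := (R : Set (Sym2 V))) (by
    intro S hS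
    obtain ⟨T, hT, hST⟩ := hmeet S hS
    obtain ⟨u, v, hu, hv, huv, h⟩ := (hρ T (htri T hT)).2 S hS hST
    exact ⟨u, v, hu, hv, huv, Finset.mem_coe.2 (Finset.mem_biUnion.2 ⟨T, hT, h⟩)⟩)
  have hSle : #({x, y, z, w} : Finset V) = 4 := by
    rw [Finset.card_insert_of_notMem, Finset.card_insert_of_notMem, Finset.card_pair hzw.ne]
    · simp [hyz.ne, hyw.ne]
    · simp [hxy.ne, hxz.ne, hxw.ne]
  -- A vertex outside the `K₄` has at most one neighbour in it, by bowtie-freeness. The crude `j =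
  -- 4` inside suffices: twice the pair count drops by `4n - 32`, while restoring `R` adds at most
  -- `8n/3`.
  have hbound := two_mul_card_adjPairs_le hfree (S := {x, y, z, w}) (j := 4) (k := 1)
    (m := Fintype.card V - 4) (by omega) ?_ ?_
  · have hdel := card_adjPairs_le_deleteEdges (G := G) R
    rw [hSle] at hbound
    obtain ⟨k, hk⟩ := Nat.exists_eq_add_of_le hV
    rw [hk] at hbound hcard ⊢
    rw [show 30 + k - 4 = 26 + k by omega] at hbound
    nlinarith
  · intro t _
    rw [← hSle]
    exact nbrCount_le_card _ _
  · intro t ht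
    simp only [Finset.mem_insert, Finset.mem_singleton, not_or] at ht
    obtain ⟨htx, hty, htz, htw⟩ := ht
    have hpair : ∀ {a b c d : V}, G.Adj a b → G.Adj a c → G.Adj a d → G.Adj c d → b ≠ c →
        b ≠ d → t ≠ c → t ≠ d → G.Adj t a → G.Adj t b → False :=
      fun hab hac had hcd hbc hbd htc htd hta htb =>
        hG hta.symm hab hac had htb hcd htc htd hbc hbd
    refine nbrCount_le_one fun a haS b hbS ha hb => ?_
    have hta := G.deleteEdges_le _ ha
    have htb := G.deleteEdges_le _ hb
    have hxy' := hpair hxy hxz hxw hzw hyz.ne hyw.ne htz htw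
    have hxz' := hpair hxz hxy hxw hyw hyz.ne' hzw.ne hty htw
    have hxw' := hpair hxw hxy hxz hyz hyw.ne' hzw.ne' hty htz
    have hyz' := hpair hyz hxy.symm hyw hxw hxz.ne' hzw.ne htx htw
    have hyw' := hpair hyw hxy.symm hyz hxz hxw.ne' hzw.ne' htx htz
    have hzw' := hpair hzw hxz.symm hyz.symm hxy hxw.ne' hyw.ne' htx hty
    simp only [Finset.mem_insert, Finset.mem_singleton] at haS hbS
    rcases haS with rfl | rfl | rfl | rfl <;> rcases hbS with rfl | rfl | rfl | rfl <;>
      first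
      | rfl
      | exact (hxy' hta htb).elim | exact (hxy' htb hta).elim
      | exact (hxz' hta htb).elim | exact (hxz' htb hta).elim
      | exact (hxw' hta htb).elim | exact (hxw' htb hta).elim
      | exact (hyz' hta htb).elim | exact (hyz' htb hta).elim
      | exact (hyw' hta htb).elim | exact (hyw' htb hta).elim
      | exact (hzw' hta htb).elim | exact (hzw' htb hta).elim

/-- A vertex sees at most one end of each edge of the cycle; summing over the five edges, it sees at
most two of its vertices. The deficit `2n - 5` exceeds the `4n/3` that `R` can restore. -/
theorem two_mul_card_adjPairs_le_of_five_cycle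
    (hG : ∀ ⦃x y z : V⦄, G.Adj x y → G.Adj x z → G.Adj y z → False) {a b c d e : V}
    (hab : G.Adj a b) (hbc : G.Adj b c) (hcd : G.Adj c d) (hde : G.Adj d e) (hea : G.Adj e a)
    (hac : a ≠ c) (had : a ≠ d) (hbd : b ≠ d) (hbe : b ≠ e) (hce : c ≠ e) {m : ℕ}
    (hm : 5 + m = Fintype.card V) :
    2 * #(adjPairs G) ≤ 20 + 8 * m + m ^ 2 := by
  classical
  have hd : d ∉ ({e} : Finset V) := by simp [hde.ne]
  have hc : c ∉ ({d, e} : Finset V) := by simp [hcd.ne, hce]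
  have hb : b ∉ ({c, d, e} : Finset V) := by simp [hbc.ne, hbd, hbe]
  have ha : a ∉ ({b, c, d, e} : Finset V) := by simp [hab.ne, hac, had, hea.ne']
  have hS : #({a, b, c, d, e} : Finset V) = 5 := by
    rw [Finset.card_insert_of_notMem ha, Finset.card_insert_of_notMem hb,
      Finset.card_insert_of_notMem hc, Finset.card_insert_of_notMem hd, Finset.card_singleton]
  have hdeg : ∀ w, nbrCount G {a, b, c, d, e} w ≤ 2 := by
    intro w
    have h1 := nbrCount_add_nbrCount_le_one (G := G) (w := w) fun h => hG h.1 h.2 hab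
    have h2 := nbrCount_add_nbrCount_le_one (G := G) (w := w) fun h => hG h.1 h.2 hbc
    have h3 := nbrCount_add_nbrCount_le_one (G := G) (w := w) fun h => hG h.1 h.2 hcd
    have h4 := nbrCount_add_nbrCount_le_one (G := G) (w := w) fun h => hG h.1 h.2 hde
    have h5 := nbrCount_add_nbrCount_le_one (G := G) (w := w) fun h => hG h.1 h.2 hea
    rw [nbrCount_insert ha, nbrCount_insert hb, nbrCount_insert hc, nbrCount_insert hd]
    omega
  have := two_mul_card_adjPairs_le hG (S := {a, b, c, d, e}) (m := m) (by rw [hS, hm])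
    (fun w _ => hdeg w) (fun w _ => hdeg w)
  rw [hS] at this
  omega

/-- Each of the four vertices of the induced matching has one neighbour among them, while any other
vertex has at most two. The right side is `n² - 8`. -/
theorem two_mul_card_adjPairs_le_of_two_edges
    (hG : ∀ ⦃x y z : V⦄, G.Adj x y → G.Adj x z → G.Adj y z → False) {u v a b : V}
    (hua : G.Adj u a) (hvb : G.Adj v b) (huv : u ≠ v) (hab : a ≠ b) (hav : a ≠ v) (hbu : b ≠ u)
    (huv' : ¬ G.Adj u v) (hab' : ¬ G.Adj a b) (hav' : ¬ G.Adj a v) (hbu' : ¬ G.Adj b u) {m : ℕ}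
    (hm : 4 + m = Fintype.card V) :
    2 * #(adjPairs G) ≤ 8 + 8 * m + m ^ 2 := by
  classical
  have ha : a ∉ ({b} : Finset V) := by simp [hab]
  have hv : v ∉ ({a, b} : Finset V) := by simp [hav.symm, hvb.ne]
  have hu : u ∉ ({v, a, b} : Finset V) := by simp [huv, hua.ne, hbu.symm]
  have hS : #({u, v, a, b} : Finset V) = 4 := by
    rw [Finset.card_insert_of_notMem hu, Finset.card_insert_of_notMem hv,
      Finset.card_insert_of_notMem ha, Finset.card_singleton]
  have hdeg : ∀ w, nbrCount G {u, v, a, b} w =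
      nbrCount G {u} w + (nbrCount G {v} w + (nbrCount G {a} w + nbrCount G {b} w)) := by
    intro w
    rw [nbrCount_insert hu, nbrCount_insert hv, nbrCount_insert ha]
  have h0 : ∀ {x y : V}, ¬ G.Adj x y → nbrCount G {y} x = 0 ∧ nbrCount G {x} y = 0 := fun h =>
    ⟨nbrCount_singleton_eq_zero h, nbrCount_singleton_eq_zero fun h' => h h'.symm⟩
  have h1 := fun x y : V => nbrCount_singleton_le_one (G := G) x y
  have := two_mul_card_adjPairs_le hG (S := {u, v, a, b}) (m := m) (j := 1) (k := 2)
    (by rw [hS, hm]) ?_ ?_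
  · rw [hS] at this
    omega
  · intro w hw
    rw [hdeg]
    simp only [Finset.mem_insert, Finset.mem_singleton] at hw
    have hloop := h0 (G.loopless.irrefl w)
    have h2 := h0 huv'
    have h3 := h0 hab'
    have h4 := h0 hav'
    have h5 := h0 hbu'
    have h6 := h1 w u
    have h7 := h1 w v
    have h8 := h1 w a
    have h9 := h1 w b
    rcases hw with rfl | rfl | rfl | rfl <;> omega
  · intro w _
    rw [hdeg]
    have h2 := nbrCount_add_nbrCount_le_one (G := G) (w := w) fun h => hG h.1 h.2 hua
    have h3 := nbrCount_add_nbrCount_le_one (G := G) (w := w) fun h => hG h.1 h.2 hvb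
    omega

end

/-! ### The upper bound for four-cycles -/

theorem le_two_mul_half_mul_half {x n : ℕ} (h : 2 * x ≤ n ^ 2) :
    x ≤ 2 * ((n + 1) / 2 * (n / 2)) := by
  obtain ⟨k, rfl | rfl⟩ := Nat.even_or_odd' n
  · rw [show (2 * k + 1) / 2 = k by omega, show 2 * k / 2 = k by omega]
    nlinarith
  · rw [show (2 * k + 1 + 1) / 2 = k + 1 by omega, show (2 * k + 1) / 2 = k by omega]
    have : (2 * k + 1) ^ 2 = 2 * (2 * ((k + 1) * k)) + 1 := by ring
    omega

/-- The left side is at most `4n²/9`, while the right side is about `3n²/4`. -/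
theorem sq_two_mul_le {n r : ℕ} (hn : 30 ≤ n) (hr : 3 * r ≤ n) :
    2 * r * (2 * r) ≤ 3 * (((n + 1) / 2 - 1) * (n / 2 - 1)) := by
  have hr2 : 3 * r * (3 * r) ≤ n * n := Nat.mul_le_mul hr hr
  obtain ⟨k, rfl | rfl⟩ := Nat.even_or_odd' n
  · rw [show (2 * k + 1) / 2 - 1 = k - 1 by omega, show 2 * k / 2 - 1 = k - 1 by omega]
    obtain ⟨j, rfl⟩ := Nat.exists_eq_add_of_le (show 15 ≤ k by omega)
    rw [show 15 + j - 1 = 14 + j by omega]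
    nlinarith
  · rw [show (2 * k + 1 + 1) / 2 - 1 = k by omega, show (2 * k + 1) / 2 - 1 = k - 1 by omega]
    obtain ⟨j, rfl⟩ := Nat.exists_eq_add_of_le (show 14 ≤ k by omega)
    rw [show 14 + j - 1 = 13 + j by omega]
    nlinarith

section
variable {V : Type*} [Fintype V] {G : SimpleGraph V}

open scoped Classical in
theorem sum_adjPairs_eq_deleteEdges {R : Finset (Sym2 V)} (hR : ∀ e ∈ R, e ∈ G.edgeSet)
    (f : V × V → ℕ) :
    ∑ p ∈ adjPairs G, f p = ∑ p ∈ adjPairs (G.deleteEdges (R : Set (Sym2 V))), f p +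
      ∑ p with s(p.1, p.2) ∈ R, f p := by
  rw [← Finset.sum_union]
  · refine Finset.sum_congr ?_ fun _ _ => rfl
    ext p
    have := hR s(p.1, p.2)
    simp only [mem_adjPairs, Finset.mem_union, SimpleGraph.deleteEdges_adj, Finset.mem_coe,
      Finset.mem_filter, Finset.mem_univ, true_and]
    rw [SimpleGraph.mem_edgeSet] at this
    tauto
  · rw [Finset.disjoint_left]
    intro p hp hp'
    simp only [mem_adjPairs, SimpleGraph.deleteEdges_adj, Finset.mem_coe,
      Finset.mem_filter, Finset.mem_univ, true_and] at hp hp'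
    exact hp.2 hp'

theorem sum_adjPairs_squarePairs_le (hG : BowtieFree G) (hV : 6 ≤ Fintype.card V)
    {G' : SimpleGraph V} (hle : G' ≤ G) :
    ∑ p ∈ adjPairs G', #(squarePairs G p.1 p.2) ≤ #(adjPairs G') *
      (((Fintype.card V + 1) / 2 - 1) * (Fintype.card V / 2 - 1)) :=
  Finset.sum_le_card_nsmul _ _ _ fun _ hp =>
    card_squarePairs_le hG hV (hle (mem_adjPairs.1 hp))

/-- In a bowtie-free graph without four-cliques, one edge can be chosen in each of at most `n / 3`
disjoint triangles so that all triangles are destroyed. -/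
theorem BowtieFree.exists_transversal [DecidableEq V] (hG : BowtieFree G)
    (hK : ∀ T w, G.IsNClique 3 T → ¬ ∀ x ∈ T, G.Adj x w) :
    ∃ R : Finset (Sym2 V), 3 * #R ≤ Fintype.card V ∧
      (∀ S, G.IsNClique 3 S → ∃ u v, u ∈ S ∧ v ∈ S ∧ u ≠ v ∧ s(u, v) ∈ (R : Set (Sym2 V))) ∧
      ∀ u v, s(u, v) ∈ R → ∃ c, G.Adj u v ∧ G.Adj u c ∧ G.Adj v c ∧
        (∀ S, G.IsNClique 3 S → ¬ Disjoint S {u, v, c} → u ∈ S ∧ v ∈ S) ∧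
        ∀ x y, s(x, y) ∈ R → x ∈ ({u, v, c} : Finset V) → s(x, y) = s(u, v) := by
  obtain ⟨𝒯, htri, hdisj, hcard, hmeet⟩ := exists_maximal_disjoint_triangles G
  -- Choosing `e` on all sets needs a default element of `Sym2 V`.
  rcases isEmpty_or_nonempty V with hV | hV
  · refine ⟨∅, by simp, fun S hS => ?_, by simp⟩
    obtain ⟨a, -⟩ := SimpleGraph.is3Clique_iff.1 hS
    exact isEmptyElim a
  have hedge : ∀ T : Finset V, G.IsNClique 3 T → ∃ e : Sym2 V, ∃ u v c,
      e = s(u, v) ∧ G.Adj u v ∧ G.Adj u c ∧ G.Adj v c ∧ T = {u, v, c} ∧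
      ∀ S, G.IsNClique 3 S → ¬ Disjoint S T → u ∈ S ∧ v ∈ S := by
    intro T hT
    obtain ⟨u, v, c, h⟩ := hG.exists_edge_mem_of_not_disjoint hT fun w => hK T w hT
    exact ⟨s(u, v), u, v, c, rfl, h⟩
  have : Nonempty (Sym2 V) := hV.map Sym2.diag
  choose! e he using hedge
  have hmemT : ∀ T ∈ 𝒯, ∀ x y, s(x, y) = e T → x ∈ T := by
    intro T hT x y hxy
    obtain ⟨u, v, c, heq, -, -, -, hTeq, -⟩ := he T (htri T hT)
    rw [heq, Sym2.eq_iff] at hxy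
    rw [hTeq]
    rcases hxy with ⟨rfl, rfl⟩ | ⟨rfl, rfl⟩ <;> simp
  refine ⟨𝒯.image e, ?_, ?_, ?_⟩
  · have : #(𝒯.image e) ≤ #𝒯 := Finset.card_image_le
    omega
  · intro S hS
    obtain ⟨T, hT, hST⟩ := hmeet S hS
    obtain ⟨u, v, c, heq, huv, -, -, -, h⟩ := he T (htri T hT)
    exact ⟨u, v, (h S hS hST).1, (h S hS hST).2, huv.ne,
      Finset.mem_coe.2 (Finset.mem_image.2 ⟨T, hT, heq⟩)⟩
  · intro u v huv
    obtain ⟨T, hT, heT⟩ := Finset.mem_image.1 huv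
    -- The packing triangles are disjoint, so each vertex of `T` lies on no chosen edge other than
    -- that of `T`.
    have huniq : ∀ x y, s(x, y) ∈ 𝒯.image e → x ∈ T → s(x, y) = s(u, v) := by
      intro x y hxy hx
      obtain ⟨T', hT', heT'⟩ := Finset.mem_image.1 hxy
      have hx' := hmemT T' hT' x y heT'.symm
      have : T' = T := by
        by_contra hne
        exact Finset.disjoint_left.1 (hdisj hT' hT hne) hx' hx
      rw [← heT', ← heT, this]
    obtain ⟨u', v', c, heq, huv', huc, hvc, hTeq, h⟩ := he T (htri T hT)
    rw [heT, Sym2.eq_iff] at heq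
    rcases heq with ⟨rfl, rfl⟩ | ⟨rfl, rfl⟩
    · exact ⟨c, huv', huc, hvc, hTeq ▸ h, hTeq ▸ huniq⟩
    · rw [Finset.insert_comm] at hTeq
      exact ⟨c, huv'.symm, hvc, huc, fun S hS hST => (h S hS (hTeq ▸ hST)).symm, hTeq ▸ huniq⟩

theorem BowtieFree.labelledCopyCount_cycleGraph_four_le (hG : BowtieFree G)
    (hV : 30 ≤ Fintype.card V) :
    G.labelledCopyCount (SimpleGraph.cycleGraph 4) ≤
      2 * ((Fintype.card V + 1) / 2 * (Fintype.card V / 2) *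
        (((Fintype.card V + 1) / 2 - 1) * (Fintype.card V / 2 - 1))) := by
  classical
  rw [labelledCopyCount_cycleGraph_four, ← mul_assoc]
  by_cases hE : 2 * #(adjPairs G) ≤ Fintype.card V ^ 2
  · exact (sum_adjPairs_squarePairs_le hG (by omega) le_rfl).trans
      (Nat.mul_le_mul_right _ (le_two_mul_half_mul_half hE))
  have hK : ∀ T w, G.IsNClique 3 T → ¬ ∀ x ∈ T, G.Adj x w := by
    intro T w hT hw
    obtain ⟨x, y, z, hxy, hxz, hyz, rfl⟩ := SimpleGraph.is3Clique_iff.1 hT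
    exact hE (hG.two_mul_card_adjPairs_le_of_four_clique hxy hxz hyz (hw x (by simp))
      (hw y (by simp)) (hw z (by simp)) hV)
  obtain ⟨R, hRcard, hRtri, hR⟩ := hG.exists_transversal hK
  set G' := G.deleteEdges (R : Set (Sym2 V)) with hG'
  have hle : G' ≤ G := G.deleteEdges_le _
  have hfree := triangleFree_deleteEdges hRtri
  have hadj' : ∀ {x y}, G.Adj x y → s(x, y) ∉ R → G'.Adj x y := fun h h' =>
    SimpleGraph.deleteEdges_adj.2 ⟨h, h'⟩
  have hsquare : ∀ {u v a b}, s(u, v) ∈ R → (a, b) ∈ squarePairs G u v →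
      s(a, b) ∈ R ∧ 2 * #(adjPairs G') + 8 ≤ Fintype.card V ^ 2 := by
    intro u v a b huvR hab
    obtain ⟨hua, hab, hbv, hav, hbu⟩ := mem_squarePairs.1 hab
    obtain ⟨c, huv, huc, hvc, hS, huniq⟩ := hR u v huvR
    -- Every triangle through `u`, `v` or `c` contains both `u` and `v`. Each of the next four facts
    -- holds because its failure creates such a triangle missing `u` or `v`.
    have htri : ∀ {x y z}, G.Adj x y → G.Adj x z → G.Adj y z → x ∈ ({u, v, c} : Finset V) →
        u ∈ ({x, y, z} : Finset V) ∧ v ∈ ({x, y, z} : Finset V) := fun {x y z} hxy hxz hyz hx =>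
      hS _ (SimpleGraph.is3Clique_iff.2 ⟨x, y, z, hxy, hxz, hyz, rfl⟩)
        (Finset.not_disjoint_iff.2 ⟨x, by simp, hx⟩)
    have hac : a ≠ c := by
      rintro rfl
      have := (htri hvc hbv.symm hab (by simp)).1
      simp [huv.ne, hua.ne, hbu.symm] at this
    have hbc : b ≠ c := by
      rintro rfl
      have := (htri huc hua hab.symm (by simp)).2
      simp [huv.ne', hvc.ne, hav.symm] at this
    have hav' : ¬ G.Adj a v := by
      intro h
      have := (htri h.symm hbv.symm hab (by simp)).1
      simp [huv.ne, hua.ne, hbu.symm] at this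
    have hbu' : ¬ G.Adj b u := by
      intro h
      have := (htri h.symm hua hab.symm (by simp)).2
      simp [huv.ne', hbv.ne', hav.symm] at this
    -- `uv` is the only edge of `R` at `u`, `v` or `c`, so `ua`, `vb`, `uc` and `vc` survive in
    -- `G'`.
    have hua' : G'.Adj u a := hadj' hua fun h => by
      have := huniq u a h (by simp)
      simp [hav, huv.ne] at this
    have hvb' : G'.Adj v b := hadj' hbv.symm fun h => by
      have := huniq v b h (by simp)
      simp [hbu, huv.ne'] at this
    have huc' : G'.Adj u c := hadj' huc fun h => by
      have := huniq u c h (by simp)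
      simp [hvc.ne', huv.ne] at this
    have hvc' : G'.Adj v c := hadj' hvc fun h => by
      have := huniq v c h (by simp)
      simp [huc.ne', huv.ne'] at this
    have habR : s(a, b) ∈ R := by
      -- Otherwise `u a b v c` is a five-cycle of `G'`, and `G` has at most `n²/4` edges even after
      -- `R` is restored, against `hE`.
      by_contra habR
      obtain ⟨m, hm⟩ := Nat.exists_eq_add_of_le (show 5 ≤ Fintype.card V by omega)
      have h1 := two_mul_card_adjPairs_le_of_five_cycle hfree hua' (hadj' hab habR) hvb'.symm
        hvc' huc'.symm hbu.symm huv.ne hav hac hbc hm.symm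
      have h2 := card_adjPairs_le_deleteEdges (G := G) R
      refine hE ?_
      rw [hm] at hV hRcard ⊢
      nlinarith
    refine ⟨habR, ?_⟩
    obtain ⟨m, hm⟩ := Nat.exists_eq_add_of_le (show 4 ≤ Fintype.card V by omega)
    have h1 := two_mul_card_adjPairs_le_of_two_edges hfree hua' hvb' huv.ne hab.ne hav hbu
      (fun h => (SimpleGraph.deleteEdges_adj.1 h).2 huvR)
      (fun h => (SimpleGraph.deleteEdges_adj.1 h).2 habR) (fun h => hav' (hle h))
      (fun h => hbu' (hle h)) hm.symm
    rw [hm]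
    nlinarith
  have hbound' := sum_adjPairs_squarePairs_le hG (by omega) hle
  rw [sum_adjPairs_eq_deleteEdges (R := R) (fun e he => by
    induction e with
    | _ u v => exact (hR u v he).choose_spec.1) fun p => #(squarePairs G p.1 p.2)]
  set M := ((Fintype.card V + 1) / 2 - 1) * (Fintype.card V / 2 - 1) with hM
  by_cases hempty : ∀ p : V × V, s(p.1, p.2) ∈ R → squarePairs G p.1 p.2 = ∅
  · rw [Finset.sum_eq_zero (s := univ.filter fun p : V × V => s(p.1, p.2) ∈ R) fun p hp => by
      rw [hempty p (Finset.mem_filter.1 hp).2, Finset.card_empty], add_zero]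
    refine hbound'.trans (Nat.mul_le_mul_right _ (le_two_mul_half_mul_half ?_))
    rw [card_adjPairs]
    exact two_mul_adjCount_le_sq hfree univ
  · push Not at hempty
    obtain ⟨p, hp, q, hq⟩ := hempty
    -- One square on an edge of `R` suffices to leave `G'` four ordered pairs below the maximum.
    have hlt := le_two_mul_half_mul_half (x := #(adjPairs G') + 4) (n := Fintype.card V)
      (by have := (hsquare hp hq).2; omega)
    -- Both `uv` and the opposite edge `ab` lie in `R`, and each has at most `2 * #R` orientations
    -- in total.
    have hsum : ∑ p : V × V with s(p.1, p.2) ∈ R, #(squarePairs G p.1 p.2) ≤ 2 * #R * (2 * #R) := by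
      refine (Finset.sum_le_card_nsmul _ _ (2 * #R) fun p hp => ?_).trans
        (Nat.mul_le_mul_right _ (card_filter_mk_mem_le R))
      refine (Finset.card_le_card ?_).trans (card_filter_mk_mem_le R)
      intro q hq
      exact Finset.mem_filter.2 ⟨Finset.mem_univ _, (hsquare (Finset.mem_filter.1 hp).2 hq).1⟩
    have hsq := sq_two_mul_le hV hRcard
    rw [← hM] at hsq
    have := Nat.mul_le_mul_right M hlt
    nlinarith

end

end GenTuran

theorem proposition3p9 :
    GenTuran.IsTuranGood (SimpleGraph.cycleGraph 4) GenTuran.fanTwo ∧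
      ¬ ∃ e : Sym2 (Fin 5), GenTuran.IsColorCritical GenTuran.fanTwo e := by
  refine ⟨⟨3, by norm_num, GenTuran.fanTwo_chromaticNumber, GenTuran.fanTwo_free_cycleGraph_four,
    30, fun n hn => ?_⟩, fun ⟨e, he⟩ => GenTuran.fanTwo_not_isColorCritical e he⟩
  classical
  refine le_antisymm (Finset.sup_le fun G hG => ?_) ?_
  · have hfree := GenTuran.bowtieFree_of_free (Finset.mem_filter.1 hG).2
    have hle := hfree.labelledCopyCount_cycleGraph_four_le (by rwa [Fintype.card_fin])
    rw [Fintype.card_fin] at hle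
    have h := hle.trans (GenTuran.le_labelledCopyCount_turanGraph_two n)
    -- Both labelled counts carry the same positive factor, the number of automorphisms of the
    -- four-cycle, which cancels.
    rw [GenTuran.labelledCopyCount_eq_copyCount_mul,
      GenTuran.labelledCopyCount_eq_copyCount_mul] at h
    have : Finite (SimpleGraph.cycleGraph 4 ≃g SimpleGraph.cycleGraph 4) :=
      Finite.of_injective (fun e => (e : Fin 4 → Fin 4)) DFunLike.coe_injective
    exact Nat.le_of_mul_le_mul_right h Nat.card_pos
  · exact Finset.le_sup (f := fun G : SimpleGraph (Fin n) =>
      G.copyCount (SimpleGraph.cycleGraph 4)) (Finset.mem_filter.2 ⟨Finset.mem_univ _,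
        GenTuran.fanTwo_free_turanGraph_two n⟩)
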